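/- Let $F$ be a finitely generated free group of rank at least $2$ and let $\varphi : F \to F$ be an injective endomorphism. Let $\Gamma$ be a finite connected graph without univalent vertices, $\alpha : F \to \pi_1(\Gamma)$ an isomorphism (a marking), and $f : \Gamma \to \Gamma$ a topological representative of $\varphi$: $f$ maps vertices to vertices, is locally injective in the interior of edges and at bivalent vertices, and $f_*\alpha$ equals $\alpha\varphi$ up to an inner automorphism. Suppose that $f$ is *clean*, that is: * $f$ is a train track: all iterates $f^n$ ($n \ge 1$) are locally injective in the interior of edges and at bivalent vertices; * $f$ is irreducible: every edge lies in the image of some iterate of every edge; moreover there is an $n \ge 1$ such that $f^n$ maps every edge onto all of $\Gamma$; * for every vertex $v$ the Whitehead graph at $v$ is connected; its vertices are the half-edges at $v$, and two distinct half-edges are joined if the turn they form is taken by $f^n(e)$ for some edge $e$ and some $n \ge 1$. Give $\Gamma$ the train track metric (edge lengths form a positive left eigenvector of the transition matrix, for the Perron–Frobenius eigenvalue $\lambda_f > 1$), for which $f$ stretches each edge linearly by $\lambda_f$. A *leaf* of the attracting lamination $\Lambda(f)$ is an isometric immersion $\gamma : \mathbb{R} \to \Gamma$ such that $\gamma(0)$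 is not a vertex and, for some $k \ge 1$, $f^k(\gamma(r)) = \gamma(\lambda_f^k r)$ for all $r \in \mathbb{R}$. For a subgroup $H \le F$, the Stallings graph $S(H)$ is the core of the cover of $\Gamma$ corresponding to $H$, i.e. the union of all immersed loops in that cover; $H$ *supports a leaf of* $\Lambda(f)$ if some leaf of $\Lambda(f)$ lifts to $S(H)$. If $H \le F$ is a nontrivial finitely generated subgroup that supports a leaf of $\Lambda(f)$, then, up to replacing $H$ by a conjugate, $\varphi^k(F) \cap H$ has finite index in $\varphi^k(F)$ for some $k \ge 0$; that is, there are $k \ge 0$ and $g \in F$ with $$[\varphi^k(F) : \varphi^k(F) \cap gHg^{-1}] < \infty .$$ -/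

import Mathlib

/-- A graph (1-dimensional CW complex) with vertex set `V` and edge set `E`, each edge coming with
an arbitrary orientation; loops and multiple edges are allowed.  An *oriented edge* is an element of
`E × Bool`: `(e, true)` is `e` traversed from `src e` to `tgt e`, and `(e, false)` is `e` traversed
backwards.  This agrees with Mathlib's convention for words in `FreeGroup E`. Identifying a half-edge
with the oriented edge leaving through it, oriented edges are also the half-edges of the graph. -/
structure EdgeGraph (V E : Type*) where
  src : E → V
  tgt : E → V

namespace EdgeGraph

variable {V E : Type*}

/-- The initial vertex of an oriented edge. -/
def origin (G : EdgeGraph V E) (a : E × Bool) : V := if a.2 then G.src a.1 else G.tgt a.1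

/-- The terminal vertex of an oriented edge. -/
def terminus (G : EdgeGraph V E) (a : E × Bool) : V := if a.2 then G.tgt a.1 else G.src a.1

/-- The same edge with the opposite orientation. -/
def opp (a : E × Bool) : E × Bool := (a.1, !a.2)

/-- `G.IsPath u L v`: the list `L` of oriented edges is an edge path from `u` to `v`. It is *immersed*
(has no backtracking) if and only if `FreeGroup.IsReduced L`. -/
def IsPath (G : EdgeGraph V E) : V → List (E × Bool) → V → Prop
  | u, [], v => u = v
  | u, a :: L, v => G.origin a = u ∧ G.IsPath (G.terminus a) L v

theorem IsPath.append {G : EdgeGraph V E} {u v w : V} {L M : List (E × Bool)}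
    (hL : G.IsPath u L v) (hM : G.IsPath v M w) : G.IsPath u (L ++ M) w := by
  induction L generalizing u with
  | nil => cases hL; exact hM
  | cons a L ih => exact ⟨hL.1, ih hL.2⟩

theorem IsPath.invRev {G : EdgeGraph V E} {u v : V} {L : List (E × Bool)}
    (hL : G.IsPath u L v) : G.IsPath v (FreeGroup.invRev L) u := by
  induction L generalizing u with
  | nil => exact hL.symm
  | cons a L ih =>
    have h : FreeGroup.invRev (a :: L) = FreeGroup.invRev L ++ [opp a] := by
      simp [FreeGroup.invRev, opp]
    rw [h]
    refine (ih hL.2).append ?_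
    have h1 := hL.1
    rcases a with ⟨e, b⟩
    cases b <;> simp_all [IsPath, opp, origin, terminus]

/-- The graph is (nonempty and) connected. -/
def IsConnected (G : EdgeGraph V E) : Prop := Nonempty V ∧ ∀ u v, ∃ L, G.IsPath u L v

/-- The half-edges attached to the vertex `v`. -/
abbrev HalfEdge (G : EdgeGraph V E) (v : V) : Type _ := {a : E × Bool // G.origin a = v}

/-- No vertex is univalent. -/
def IsCoreGraph (G : EdgeGraph V E) : Prop := ∀ v, Nat.card (G.HalfEdge v) ≠ 1

/-- The fundamental group `π₁(G, v)`.  A homotopy class (rel endpoints) of edge paths contains exactly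
one reduced edge path, so it is recorded by the element of `FreeGroup E` spelled by any of its
members; `π₁(G, v)` is the subgroup of `FreeGroup E` of the classes of closed paths at `v`. -/
def fundamentalGroup (G : EdgeGraph V E) (v : V) : Subgroup (FreeGroup E) where
  carrier := {x | ∃ L, G.IsPath v L v ∧ x = FreeGroup.mk L}
  one_mem' := ⟨[], rfl, rfl⟩
  mul_mem' := by
    rintro _ _ ⟨L, hL, rfl⟩ ⟨M, hM, rfl⟩
    exact ⟨L ++ M, hL.append hM, FreeGroup.mul_mk⟩
  inv_mem' := by
    rintro _ ⟨L, hL, rfl⟩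
    exact ⟨FreeGroup.invRev L, hL.invRev, FreeGroup.inv_mk⟩

/-! ### Covers and Stallings subgroup graphs -/

/-- Vertices of the cover of `G` corresponding to `K ≤ π₁(G, v₀)`: a vertex over `v` is a homotopy
class of paths from `v` to `v₀`, up to right multiplication by `K`. -/
abbrev CoverVertex (G : EdgeGraph V E) (v₀ : V) (K : Subgroup (FreeGroup E)) : Type _ :=
  {p : V × (FreeGroup E ⧸ K) //
    ∃ L, G.IsPath p.1 L v₀ ∧ p.2 = QuotientGroup.mk (FreeGroup.mk L)}

/-- Edges of the cover: an edge over `e` is determined by its initial vertex, a vertex over `src e`. -/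
abbrev CoverEdge (G : EdgeGraph V E) (v₀ : V) (K : Subgroup (FreeGroup E)) : Type _ :=
  {p : E × (FreeGroup E ⧸ K) //
    ∃ L, G.IsPath (G.src p.1) L v₀ ∧ p.2 = QuotientGroup.mk (FreeGroup.mk L)}

/-- The cover of (the connected graph) `G` corresponding to `K ≤ π₁(G, v₀)`.  The edge over `e`
leaving the class of a path `L` ends at the class of the path `e⁻¹ L`. -/
def cover (G : EdgeGraph V E) (v₀ : V) (K : Subgroup (FreeGroup E)) :
    EdgeGraph (G.CoverVertex v₀ K) (G.CoverEdge v₀ K) where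
  src p := ⟨(G.src p.1.1, p.1.2), p.2⟩
  tgt p := ⟨(G.tgt p.1.1, (FreeGroup.of p.1.1)⁻¹ • p.1.2), by
    obtain ⟨⟨e, c⟩, L, hL, hc⟩ := p
    refine ⟨(e, false) :: L, ⟨by simp [origin], by simpa [terminus] using hL⟩, ?_⟩
    change c = _ at hc
    subst hc
    have h : FreeGroup.mk ((e, false) :: L) = (FreeGroup.of e)⁻¹ * FreeGroup.mk L := by
      simp [FreeGroup.of, FreeGroup.inv_mk, FreeGroup.mul_mk, FreeGroup.invRev]
    rw [h]
    rfl⟩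

/-- The edge `e` lies on an immersed loop of `G` (a cyclically reduced closed edge path). -/
def InCore (G : EdgeGraph V E) (e : E) : Prop :=
  ∃ v L, G.IsPath v L v ∧ FreeGroup.IsCyclicallyReduced L ∧ ∃ s, (e, s) ∈ L

/-- The core of `G`: the smallest subgraph containing all immersed loops. -/
def core (G : EdgeGraph V E) :
    EdgeGraph {v : V // ∃ e, G.InCore e ∧ (G.src e = v ∨ G.tgt e = v)} {e : E // G.InCore e} where
  src e := ⟨G.src e.1, e.1, e.2, Or.inl rfl⟩
  tgt e := ⟨G.tgt e.1, e.1, e.2, Or.inr rfl⟩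

/-- The subgroup of `FreeGroup E` corresponding to `H ≤ F` under a marking `α : F ≅ π₁(G, v₀)`. -/
def markedSubgroup {F : Type*} [Group F] {G : EdgeGraph V E} {v₀ : V}
    (α : F ≃* G.fundamentalGroup v₀) (H : Subgroup F) : Subgroup (FreeGroup E) :=
  H.map ((G.fundamentalGroup v₀).subtype.comp α.toMonoidHom)

/-- The Stallings subgroup graph `S(H)` of `H ≤ F` with respect to a marking `α : F ≅ π₁(G, v₀)`:
the core of the cover of `G` corresponding to `H`. -/
abbrev stallingsGraph {F : Type*} [Group F] {G : EdgeGraph V E} {v₀ : V}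
    (α : F ≃* G.fundamentalGroup v₀) (H : Subgroup F) :=
  (G.cover v₀ (markedSubgroup α H)).core

/-- A bi-infinite immersed edge path, i.e. the edge itinerary of an immersion `ℝ → G`. -/
def IsImmersedLine (G : EdgeGraph V E) (γ : ℤ → E × Bool) : Prop :=
  ∀ i, G.terminus (γ i) = G.origin (γ (i + 1)) ∧ γ (i + 1) ≠ opp (γ i)

/-- The immersed line `γ` in `G` has a lift to the Stallings subgroup graph `S(H)`. -/
def LiftsTo {F : Type*} [Group F] {G : EdgeGraph V E} {v₀ : V}
    (α : F ≃* G.fundamentalGroup v₀) (H : Subgroup F) (γ : ℤ → E × Bool) : Prop :=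
  ∃ γ' : ℤ → {e : G.CoverEdge v₀ (markedSubgroup α H) //
      (G.cover v₀ (markedSubgroup α H)).InCore e} × Bool,
    (stallingsGraph α H).IsImmersedLine γ' ∧ ∀ i, ((γ' i).1.1.1.1, (γ' i).2) = γ i

/-! ### Graph maps and train tracks -/

/-- A graph self-map: it maps vertices to vertices and each edge `e` along an edge path `onE e`. -/
structure SelfMap (G : EdgeGraph V E) where
  onV : V → V
  onE : E → List (E × Bool)
  isPath : ∀ e, G.IsPath (onV (G.src e)) (onE e) (onV (G.tgt e))

namespace SelfMap

variable {G : EdgeGraph V E}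

/-- The image of an oriented edge, as an edge path. -/
def onOriented (f : G.SelfMap) (a : E × Bool) : List (E × Bool) :=
  if a.2 then f.onE a.1 else FreeGroup.invRev (f.onE a.1)

/-- The edge path `fⁿ(a)`, for an oriented edge `a` (no cancellation is performed). -/
def iter (f : G.SelfMap) (n : ℕ) (a : E × Bool) : List (E × Bool) :=
  (fun L => L.flatMap f.onOriented)^[n] [a]

/-- The iterate `fⁿ` is locally injective in the interior of edges (every edge is mapped to a
nontrivial edge path without backtracking) and at bivalent vertices (the two half-edges there have
images starting with different half-edges). -/
def IsTight (f : G.SelfMap) (n : ℕ) : Prop :=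
  (∀ a, f.iter n a ≠ [] ∧ FreeGroup.IsReduced (f.iter n a)) ∧
  ∀ v, Nat.card (G.HalfEdge v) = 2 → ∀ a b : G.HalfEdge v, a ≠ b →
    (f.iter n a.1).head? ≠ (f.iter n b.1).head?

/-- `f` is a train track map. -/
def IsTrainTrack (f : G.SelfMap) : Prop := ∀ n, 1 ≤ n → f.IsTight n

/-- `f` is an irreducible train track map: every edge is in the image of an iterate of every edge. -/
def IsIrreducibleTrainTrack (f : G.SelfMap) : Prop :=
  f.IsTrainTrack ∧ ∀ e e' : E, ∃ n, 1 ≤ n ∧ ∃ s, (e, s) ∈ f.iter n (e', true)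

/-- The edge path `L` takes the turn `{a, b}` (of half-edges at a common vertex). -/
def TakesTurn (L : List (E × Bool)) (a b : E × Bool) : Prop :=
  [opp a, b] <:+: L ∨ [opp b, a] <:+: L

/-- The Whitehead graph of `f` at `v`: its vertices are the half-edges at `v`, and its edges are the
turns taken by the images of edges under iterates of `f`. -/
def whiteheadGraph (f : G.SelfMap) (v : V) : SimpleGraph (G.HalfEdge v) where
  Adj a b := a ≠ b ∧ ∃ n e, 1 ≤ n ∧ TakesTurn (f.iter n (e, true)) a.1 b.1
  symm := ⟨by
    rintro a b ⟨hab, n, e, hn, h⟩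
    exact ⟨hab.symm, n, e, hn, h.symm⟩⟩
  loopless := ⟨fun _ h => h.1 rfl⟩

/-- Weakly clean: an irreducible train track map whose Whitehead graphs are connected. -/
def IsWeaklyClean (f : G.SelfMap) : Prop :=
  f.IsIrreducibleTrainTrack ∧ ∀ v, (f.whiteheadGraph v).Connected

/-- Clean: weakly clean, and some iterate maps every edge onto the whole graph. -/
def IsClean (f : G.SelfMap) : Prop :=
  f.IsWeaklyClean ∧ ∃ n, 1 ≤ n ∧ ∀ e e' : E, ∃ s, (e, s) ∈ f.iter n (e', true)

/-- `f` is a topological representative of the endomorphism `φ` of `F` with respect to the marking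
`α : F ≅ π₁(G, v₀)`: `f_* ∘ α` and `α ∘ φ` agree up to the change of basepoint along some path `L`
from `v₀` to `f(v₀)` (a different choice of `L` amounts to an inner automorphism). -/
def Represents {F : Type*} [Group F] {v₀ : V} (f : G.SelfMap)
    (α : F ≃* G.fundamentalGroup v₀) (φ : F →* F) : Prop :=
  G.IsConnected ∧ G.IsCoreGraph ∧ f.IsTight 1 ∧
  ∃ L, G.IsPath v₀ L (f.onV v₀) ∧ ∀ w : F,
    ((α (φ w) : G.fundamentalGroup v₀) : FreeGroup E) =
      FreeGroup.mk L * FreeGroup.lift (fun e => FreeGroup.mk (f.onE e)) (α w : FreeGroup E) *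
        (FreeGroup.mk L)⁻¹

/-! ### The attracting lamination -/

/-- The train track metric: `ℓ` is a positive left eigenvector of the transition matrix, with
eigenvalue `lam` (which is then the Perron-Frobenius eigenvalue).  With the length `ℓ e` given to each
edge `e`, the map `f` is taken to stretch every edge linearly by the factor `lam`. -/
def IsTrainTrackMetric (f : G.SelfMap) (lam : ℝ) (ℓ : E → ℝ) : Prop :=
  (∀ e, 0 < ℓ e) ∧ ∀ e, ((f.onE e).map fun a => ℓ a.1).sum = lam * ℓ e

/-- The immersed line `γ` is a leaf of the attracting lamination `Λ(f)` of an expanding irreducible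
train track map `f`.

An isometric immersion `γ : ℝ → G` (for the train track metric) is given by its edge itinerary
`γ : ℤ → E × Bool` and the times `t i` at which it passes the vertices: it runs through `γ i` during
`[t i, t (i + 1)]`. That `x = γ(0)` is not a vertex is expressed by `t 0 < 0 < t 1`. The
identity `f^k(γ(r)) = γ(lam^k * r)` for all `r` says that each edge `γ i` is mapped by `f^k` to the
part of `γ` between the times `lam^k * t i` and `lam^k * t (i + 1)`, which are the times `t (m i)`
and `t (m (i + 1))`. -/
def IsLeaf (f : G.SelfMap) (γ : ℤ → E × Bool) : Prop :=
  G.IsImmersedLine γ ∧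
  ∃ (lam : ℝ) (ℓ : E → ℝ), 1 < lam ∧ f.IsTrainTrackMetric lam ℓ ∧
  ∃ t : ℤ → ℝ, (∀ i, t (i + 1) = t i + ℓ (γ i).1) ∧ t 0 < 0 ∧ 0 < t 1 ∧
  ∃ k : ℕ, 1 ≤ k ∧ ∃ m : ℤ → ℤ, ∀ i,
    t (m i) = lam ^ k * t i ∧ m (i + 1) = m i + (f.iter k (γ i)).length ∧
    ∀ (j : ℕ) (a : E × Bool), (f.iter k (γ i))[j]? = some a → γ (m i + j) = a

/-- The subgroup `H` supports a leaf of the attracting lamination `Λ(f)`. -/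
def SupportsLeaf {F : Type*} [Group F] {v₀ : V} (f : G.SelfMap)
    (α : F ≃* G.fundamentalGroup v₀) (H : Subgroup F) : Prop :=
  ∃ γ : ℤ → E × Bool, f.IsLeaf γ ∧ LiftsTo α H γ

end SelfMap

end EdgeGraph

/-! Let `K` be the image of `H` under the marking and `C` the edge set of its Stallings graph,
encoded by pairs (edge, coset of `K`). Since `H` is finitely generated, `C` is finite over each edge
(`finite_coreEdges`), so each nonempty path has finitely many lifts to `C`. Count the lifts of
`f^n(a)`. Passing to a subpath can only increase the count, and every sufficiently high iterate of
an edge contains a path with the minimal count, so the count is eventually constant. Then, for large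
`n`, whenever the turn between `a` and `b` is taken, every lift of `f^n(a⁻¹)` extends along
`f^n(b)`. Connectedness of the Whitehead graphs spreads this to all half-edges at a vertex
(`IsClean.exists_iterate_reads`). The leaf provides at least one lift, because it contains all the
paths `f^n(e)` up to orientation. Hence, from a suitable coset `c`, the `f^k`-images of all loops at
`v₀` lift to `C`. The translates of `c` by these images form a finite set, so the stabilizer of `c`
pulls back to a finite-index subgroup of `F`, and `φ^k` sends it into a conjugate of `H`. -/

namespace FreeGroup

/-! ### Reduced words and finitely generated subgroups of free groups. -/

variable {E : Type*}

theorem _root_.List.prefix_or_of_prefix_append {β : Type*} {p L M : List β} (h : p <+: L ++ M) :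
    p <+: L ∨ ∃ q, p = L ++ q ∧ q <+: M := by
  obtain ⟨t, ht⟩ := h
  rcases List.append_eq_append_iff.1 ht with ⟨a, h1, -⟩ | ⟨a, h1, h2⟩
  · exact Or.inl ⟨a, h1.symm⟩
  · exact Or.inr ⟨a, h1, t, h2.symm⟩

/-- A prefix reaching past a cancelled pair becomes a prefix of the longer word once the pair is
reinserted, which does not change the group element. -/
theorem Red.exists_prefix {L M : List (E × Bool)} (h : Red L M) {p : List (E × Bool)}
    (hp : p <+: M) : ∃ q, q <+: L ∧ mk q = mk p := by
  induction h generalizing p with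
  | refl => exact ⟨p, hp, rfl⟩
  | tail _ hs ih =>
    cases hs with
    | @not L₁ L₂ x b =>
      rcases List.prefix_or_of_prefix_append hp with h1 | ⟨q, rfl, hq⟩
      · exact ih (h1.trans (List.prefix_append _ _))
      · obtain ⟨r, hr, hr'⟩ := ih (p := L₁ ++ (x, b) :: (x, !b) :: q) (by
          obtain ⟨s, rfl⟩ := hq
          exact ⟨s, by simp⟩)
        exact ⟨r, hr, hr'.trans (Quot.sound Red.Step.not)⟩

/-- Each letter of `P` cancels at most one letter, so `W₁` absorbs all cancellation and `W₂`
survives intact. The length bound guarantees in the induction that a letter is left to cancel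
against. -/
theorem exists_append_isReduced (W₁ W₂ P : List (E × Bool)) (hW : IsReduced (W₁ ++ W₂))
    (hP : P.length ≤ W₁.length) :
    ∃ X, mk X = mk (P ++ W₁) ∧ IsReduced (X ++ W₂) ∧ W₁.length ≤ X.length + P.length := by
  induction P with
  | nil => exact ⟨W₁, rfl, hW, by simp⟩
  | cons a P ih =>
    simp only [List.length_cons] at hP
    obtain ⟨X, hX, hr, hl⟩ := ih (by omega)
    cases X with
    | nil => simp at hl; omega
    | cons x X =>
      by_cases hax : a.1 = x.1 → a.2 = x.2
      · refine ⟨a :: x :: X, ?_, isReduced_cons_cons.2 ⟨hax, hr⟩, ?_⟩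
        · have := congrArg (fun y => mk [a] * y) hX
          simpa [mul_mk] using this
        · simp at hl ⊢; omega
      · obtain ⟨h1, h2⟩ := Classical.not_imp.1 hax
        refine ⟨X, ?_, hr.infix ⟨[x], [], by simp⟩, ?_⟩
        · have := congrArg (fun y => mk [a] * y) hX
          simp only [mul_mk, List.nil_append, List.cons_append] at this ⊢
          rw [← this]
          obtain ⟨e, b⟩ := a
          obtain ⟨e', b'⟩ := x
          obtain rfl : e = e' := h1
          obtain rfl : b' = !b := by cases b <;> cases b' <;> simp_all
          exact (Quot.sound Red.Step.cons_not).symm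
        · simp at hl ⊢; omega

theorem IsReduced.invRev {L : List (E × Bool)} (h : IsReduced L) : IsReduced (invRev L) := by
  rw [isReduced_iff_not_step] at h ⊢
  intro M hM
  exact h _ (by simpa [invRev_invRev] using hM.invRev)

theorem exists_append_isReduced_right (W₁ W₂ P : List (E × Bool)) (hW : IsReduced (W₁ ++ W₂))
    (hP : P.length ≤ W₂.length) :
    ∃ Y, mk Y = mk (W₂ ++ P) ∧ IsReduced (W₁ ++ Y) := by
  obtain ⟨X, hX, hr, -⟩ := exists_append_isReduced (invRev W₂) (invRev W₁) (invRev P)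
    (by simpa using hW.invRev) (by simpa using hP)
  refine ⟨invRev X, ?_, by simpa using hr.invRev⟩
  rw [← inv_mk, hX, inv_mk]
  simp

/-- Finitely generated subgroups of a free group are quasiconvex. -/
theorem exists_finite_prefix_cosets {K : Subgroup (FreeGroup E)} (hK : K.FG) :
    ∃ T : Set (FreeGroup E ⧸ K), T.Finite ∧ ∀ M, IsReduced M → mk M ∈ K → ∀ p, p <+: M →
      (QuotientGroup.mk (mk p)⁻¹ : FreeGroup E ⧸ K) ∈ T := by
  classical
  obtain ⟨S, rfl⟩ := hK
  set K := Subgroup.closure (S : Set (FreeGroup E))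
  let T : Set (FreeGroup E ⧸ K) :=
    {QuotientGroup.mk 1} ∪ ⋃ s ∈ S, (fun p => QuotientGroup.mk (mk p)⁻¹) '' {p | p ∈ s.toWord.inits}
  have hT : T.Finite := (Set.finite_singleton _).union
    (S.finite_toSet.biUnion fun s _ => (List.finite_toSet _).image _)
  refine ⟨T, hT, ?_⟩
  -- A product of generators, written without cancelling, passes only through cosets met by prefixes
  -- of single generators; reduction creates no new cosets.
  have key : ∀ k ∈ K, ∃ L, mk L = k ∧ ∀ p, p <+: L →
      (QuotientGroup.mk (mk p)⁻¹ : FreeGroup E ⧸ K) ∈ T := by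
    intro k hk
    induction hk using Subgroup.closure_induction with
    | mem s hs =>
      refine ⟨s.toWord, mk_toWord, fun p hp => Or.inr ?_⟩
      exact Set.mem_biUnion hs ⟨p, by simpa using hp, rfl⟩
    | one =>
      refine ⟨[], rfl, fun p hp => Or.inl ?_⟩
      rw [List.prefix_nil.1 hp]
      simp [← one_eq_mk]
    | mul x y hx hy ihx ihy =>
      obtain ⟨L, rfl, hL⟩ := ihx
      obtain ⟨M, rfl, hM⟩ := ihy
      refine ⟨L ++ M, mul_mk.symm, fun p hp => ?_⟩
      rcases List.prefix_or_of_prefix_append hp with h1 | ⟨q, rfl, hq⟩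
      · exact hL p h1
      · have : (QuotientGroup.mk (mk (L ++ q))⁻¹ : FreeGroup E ⧸ K) = QuotientGroup.mk (mk q)⁻¹ := by
          rw [← mul_mk, mul_inv_rev]
          exact QuotientGroup.mk_mul_of_mem _ (K.inv_mem hx)
        rw [this]
        exact hM q hq
    | inv x hx ih =>
      obtain ⟨L, rfl, hL⟩ := ih
      refine ⟨invRev L, inv_mk.symm, fun p hp => ?_⟩
      obtain ⟨q, hq⟩ := hp
      have hq' : invRev q ++ invRev p = L := by
        rw [← invRev_append, hq, invRev_invRev]
      have : (QuotientGroup.mk (mk p)⁻¹ : FreeGroup E ⧸ K) = QuotientGroup.mk (mk (invRev q))⁻¹ := by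
        rw [QuotientGroup.eq]
        convert K.inv_mem hx using 1
        rw [← hq', ← mul_mk, ← inv_mk, ← inv_mk]
        group
      rw [this]
      exact hL _ ⟨_, hq'⟩
  intro M hM hk p hp
  obtain ⟨L, hL, hLT⟩ := key _ hk
  obtain ⟨N, hN, hN'⟩ := Red.exact.1 hL
  obtain rfl := hM.red_iff_eq.1 hN'
  obtain ⟨q, hq, hqp⟩ := Red.exists_prefix hN hp
  rw [← hqp]
  exact hLT q hq

/-- The cosets that a cyclically reduced word representing an element of a conjugate of a
finitely generated subgroup runs through form a finite set. -/
theorem finite_cyclic_prefix_cosets {K : Subgroup (FreeGroup E)} (hK : K.FG) :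
    {c : FreeGroup E ⧸ K | ∃ (d : FreeGroup E ⧸ K) (L : List (E × Bool)), L ≠ [] ∧
      (∀ n, IsReduced (List.replicate n L).flatten) ∧ mk L • d = d ∧
      ∃ Q, Q <+: L ∧ c = (mk Q)⁻¹ • d}.Finite := by
  classical
  obtain ⟨T, hT, hmem⟩ := exists_finite_prefix_cosets hK
  refine hT.subset ?_
  rintro _ ⟨d, L, hL, hred, hd, Q, ⟨Q', rfl⟩, rfl⟩
  obtain ⟨g, rfl⟩ := QuotientGroup.mk_surjective d
  set L := Q ++ Q'
  set P := g⁻¹.toWord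
  -- As many copies of `L` as `g` has letters: conjugation by `g` can cancel only into these
  -- buffers, so the middle `L` of `g⁻¹ W L W g` survives reduction.
  set W := (List.replicate P.length L).flatten
  have hWlen : P.length ≤ W.length := by
    simp only [W, List.length_flatten, List.map_replicate, List.sum_replicate, smul_eq_mul]
    exact Nat.le_mul_of_pos_right _ (List.length_pos_of_ne_nil hL)
  have hWL : W ++ L = (List.replicate (P.length + 1) L).flatten := by
    simp [W, List.replicate_succ']
  have hLW : L ++ W = (List.replicate (P.length + 1) L).flatten := by
    simp [W, List.replicate_succ]
  obtain ⟨X, hX, hXr, -⟩ := exists_append_isReduced W L P (hWL ▸ hred _) hWlen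
  obtain ⟨Y, hY, hYr⟩ := exists_append_isReduced_right L W (invRev P) (hLW ▸ hred _)
    (by simpa using hWlen)
  have hWmk : mk W = mk L ^ P.length := by
    simp [W, pow_mk]
  have hPmk : mk P = g⁻¹ := mk_toWord
  have hLK : g⁻¹ * mk L * g ∈ K := by
    have : (QuotientGroup.mk (mk L * g) : FreeGroup E ⧸ K) = QuotientGroup.mk g := hd
    have := QuotientGroup.eq.1 this.symm
    simpa [mul_assoc] using this
  have hconj : ∀ n, g⁻¹ * mk L ^ n * g ∈ K := fun n => by
    have := K.pow_mem hLK n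
    have h2 : (g⁻¹ * mk L * g) ^ n = g⁻¹ * mk L ^ n * g := by
      simpa using conj_pow (a := g⁻¹) (b := mk L) (i := n)
    rwa [h2] at this
  have hK' : mk (X ++ L ++ Y) ∈ K := by
    have : mk (X ++ L ++ Y) = g⁻¹ * mk L ^ (P.length + 1 + P.length) * g := by
      rw [← mul_mk, ← mul_mk, hX, hY, ← mul_mk (L₁ := P), ← mul_mk (L₁ := W), ← inv_mk, hPmk, hWmk, pow_add, pow_succ]
      group
    rw [this]
    exact hconj _
  have := hmem _ (hXr.append_overlap hYr hL) hK' (X ++ Q) ⟨Q' ++ Y, by simp [L]⟩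
  convert this using 1
  change (QuotientGroup.mk ((mk Q)⁻¹ * g) : FreeGroup E ⧸ K) = _
  rw [QuotientGroup.eq, ← mul_mk, hX, ← mul_mk, hPmk, hWmk]
  have := K.inv_mem (hconj P.length)
  convert this using 1
  group

end FreeGroup

/-! ### Lifts of paths to a set of edges of a Schreier graph, and their number. -/

namespace EdgeGraph

open FreeGroup

variable {V E : Type*}

/-- `Reads C L x`: starting at the point `x` of a Schreier graph of `FreeGroup E` (with vertex set
`X`, in which a word `w` leads from `x` to `w⁻¹ • x`), all the edges along `L` belong to `C`. -/
def Reads {X : Type*} [MulAction (FreeGroup E) X] (C : Set (E × X)) : List (E × Bool) → X → Prop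
  | [], _ => True
  | a :: L, x =>
    (a.1, if a.2 then x else FreeGroup.of a.1 • x) ∈ C ∧ Reads C L ((FreeGroup.mk [a])⁻¹ • x)

section Reads

variable {X : Type*} [MulAction (FreeGroup E) X] {C : Set (E × X)}

theorem reads_append {L M : List (E × Bool)} {x : X} :
    Reads C (L ++ M) x ↔ Reads C L x ∧ Reads C M ((FreeGroup.mk L)⁻¹ • x) := by
  induction L generalizing x with
  | nil => simp [Reads, ← one_eq_mk]
  | cons a L ih =>
    have : (FreeGroup.mk (a :: L))⁻¹ • x = (FreeGroup.mk L)⁻¹ • (FreeGroup.mk [a])⁻¹ • x := by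
      rw [← mul_smul, ← mul_inv_rev, mul_mk, List.singleton_append]
    simp only [List.cons_append, Reads, ih, this, and_assoc]

theorem inv_mk_singleton_false (e : E) : (FreeGroup.mk [(e, false)])⁻¹ = FreeGroup.of e := by
  rw [inv_mk]
  rfl

theorem invRev_singleton (a : E × Bool) : invRev [a] = [opp a] := rfl

theorem Reads.invRev {L : List (E × Bool)} {x : X} (h : Reads C L x) :
    Reads C (invRev L) ((FreeGroup.mk L)⁻¹ • x) := by
  induction L generalizing x with
  | nil => trivial
  | cons a L ih =>
    have h1 : (FreeGroup.mk (a :: L))⁻¹ • x = (FreeGroup.mk L)⁻¹ • (FreeGroup.mk [a])⁻¹ • x := by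
      rw [← mul_smul, ← mul_inv_rev, mul_mk, List.singleton_append]
    rw [invRev_cons, reads_append, h1, invRev_singleton]
    refine ⟨ih h.2, ?_, trivial⟩
    rw [← inv_mk, inv_inv, smul_inv_smul]
    have h2 := h.1
    obtain ⟨e, b⟩ := a
    cases b
    · rw [inv_mk_singleton_false]
      simpa [opp] using h2
    · have h3 : FreeGroup.of e • (FreeGroup.mk [(e, true)])⁻¹ • x = x := smul_inv_smul _ _
      simp only [opp, Bool.not_true, Bool.false_eq_true, if_false, h3]
      simpa using h2

theorem finite_reads (hC : ∀ e, {x | (e, x) ∈ C}.Finite) {L : List (E × Bool)} (hL : L ≠ []) :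
    {x | Reads C L x}.Finite := by
  cases L with
  | nil => exact absurd rfl hL
  | cons a L =>
    obtain ⟨e, b⟩ := a
    cases b
    · refine ((hC e).preimage ((MulAction.injective (FreeGroup.of e)).injOn)).subset ?_
      intro x hx
      simpa using hx.1
    · exact (hC e).subset fun x hx => by simpa using hx.1

/-- A lift restricts to the subpath, and translating the starting point along the preceding word is
injective. The empty path lifts everywhere, and `ncard` of an infinite set is `0`, hence `hM`. -/
theorem ncard_reads_le_of_infix (hC : ∀ e, {x | (e, x) ∈ C}.Finite) {L M : List (E × Bool)}
    (hM : M ≠ []) (h : M <:+: L) :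
    {x | Reads C L x}.ncard ≤ {x | Reads C M x}.ncard := by
  obtain ⟨A, B, rfl⟩ := h
  refine Set.ncard_le_ncard_of_injOn (fun x => (FreeGroup.mk A)⁻¹ • x) (fun x hx => ?_)
    (MulAction.injective _).injOn (finite_reads hC hM)
  exact (reads_append.1 (reads_append.1 hx).1).2

theorem ncard_reads_invRev (hC : ∀ e, {x | (e, x) ∈ C}.Finite) (L : List (E × Bool)) :
    {x | Reads C (invRev L) x}.ncard = {x | Reads C L x}.ncard := by
  rcases eq_or_ne L [] with rfl | hL
  · rfl
  have key : ∀ {L : List (E × Bool)}, L ≠ [] →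
      {x | Reads C (invRev L) x}.ncard ≤ {x | Reads C L x}.ncard := fun {L} hL =>
    Set.ncard_le_ncard_of_injOn (fun x => (FreeGroup.mk (invRev L))⁻¹ • x)
      (fun x hx => by simpa [invRev_invRev] using Reads.invRev hx)
      (MulAction.injective _).injOn (finite_reads hC hL)
  refine le_antisymm (key hL) ?_
  have hL' : invRev L ≠ [] := fun h => hL (invRev_injective h)
  simpa [invRev_invRev] using key hL'

/-- If a path has no more lifts than its continuation, then every lift of the path extends. -/
theorem Reads.append_of_ncard_le (hC : ∀ e, {x | (e, x) ∈ C}.Finite) {L M : List (E × Bool)}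
    (hL : L ≠ []) (h : {x | Reads C L x}.ncard ≤ {x | Reads C (L ++ M) x}.ncard) {x : X}
    (hx : Reads C L x) : Reads C (L ++ M) x := by
  have hsub : {x | Reads C (L ++ M) x} ⊆ {x | Reads C L x} := fun y hy => (reads_append.1 hy).1
  have := Set.eq_of_subset_of_ncard_le hsub h (finite_reads hC hL)
  exact this.ge hx

end Reads

/-! ### Covers of graphs and finiteness of the core. -/

section Cover

variable {G : EdgeGraph V E} {v₀ : V} {K : Subgroup (FreeGroup E)}

/-- The edges of the core of the cover of `G` corresponding to `K`. -/
def coreEdges (G : EdgeGraph V E) (v₀ : V) (K : Subgroup (FreeGroup E)) :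
    Set (E × (FreeGroup E ⧸ K)) :=
  {p | ∃ h, (G.cover v₀ K).InCore ⟨p, h⟩}

/-- The projection of oriented edges of a cover. -/
def coverProj (a : G.CoverEdge v₀ K × Bool) : E × Bool := (a.1.1.1, a.2)

theorem cover_terminus (a : G.CoverEdge v₀ K × Bool) :
    ((G.cover v₀ K).terminus a).1.2 =
      (FreeGroup.mk [coverProj a])⁻¹ • ((G.cover v₀ K).origin a).1.2 := by
  obtain ⟨e, b⟩ := a
  cases b
  · simp only [terminus, origin, cover, coverProj, Bool.false_eq_true, if_false]
    rw [← mul_smul, ← mul_inv_rev]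
    have : FreeGroup.of e.1.1 * FreeGroup.mk [(e.1.1, false)] = 1 := by
      have h : FreeGroup.mk [(e.1.1, false)] = (FreeGroup.of e.1.1)⁻¹ := by
        simp [FreeGroup.of, invRev]
      rw [h, mul_inv_cancel]
    rw [this, inv_one, one_smul]
  · simp only [terminus, origin, cover, coverProj, if_true]
    rfl

theorem cover_edge_coset (a : G.CoverEdge v₀ K × Bool) :
    a.1.1.2 = if a.2 then ((G.cover v₀ K).origin a).1.2
      else FreeGroup.of a.1.1.1 • ((G.cover v₀ K).origin a).1.2 := by
  obtain ⟨e, b⟩ := a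
  cases b <;> simp [origin, cover]

theorem IsPath.cover_end {x y : G.CoverVertex v₀ K} {L : List (G.CoverEdge v₀ K × Bool)}
    (h : (G.cover v₀ K).IsPath x L y) :
    y.1.2 = (FreeGroup.mk (L.map coverProj))⁻¹ • x.1.2 := by
  induction L generalizing x with
  | nil => cases h; simp [← one_eq_mk]
  | cons a L ih =>
    rw [ih h.2, cover_terminus, h.1, ← mul_smul, ← mul_inv_rev, mul_mk]
    rfl

theorem IsPath.split {G : EdgeGraph V E} {L M : List (E × Bool)} {u w : V}
    (h : G.IsPath u (L ++ M) w) : ∃ v, G.IsPath u L v ∧ G.IsPath v M w := by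
  induction L generalizing u with
  | nil => exact ⟨u, rfl, h⟩
  | cons a L ih =>
    obtain ⟨v, h1, h2⟩ := ih h.2
    exact ⟨v, ⟨h.1, h1⟩, h2⟩

/-- A covering is locally injective: if the projections of consecutive edges backtrack, the common
vertex forces both edges to carry the same coset, so the path upstairs backtracks too. -/
theorem IsPath.isReduced_map_coverProj {x y : G.CoverVertex v₀ K}
    {L : List (G.CoverEdge v₀ K × Bool)} (h : (G.cover v₀ K).IsPath x L y) (hr : IsReduced L) :
    IsReduced (L.map coverProj) := by
  induction L generalizing x with
  | nil => exact IsReduced.nil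
  | cons a L ih =>
    cases L with
    | nil => exact IsReduced.singleton
    | cons b L =>
      rw [isReduced_cons_cons] at hr
      refine isReduced_cons_cons.2 ⟨fun hab => ?_, ih h.2 hr.2⟩
      by_contra hne
      have h1 : (G.cover v₀ K).origin b = (G.cover v₀ K).terminus a := h.2.1
      refine hne (hr.1 ?_)
      obtain ⟨⟨⟨e, c⟩, he⟩, s⟩ := a
      obtain ⟨⟨⟨e', c'⟩, he'⟩, s'⟩ := b
      obtain rfl : e = e' := hab
      have h2 := congrArg (fun z => z.1.2) h1
      cases s <;> cases s' <;> simp_all [coverProj, origin, terminus, cover]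

theorem IsPath.flatten_replicate {G : EdgeGraph V E} {L : List (E × Bool)} {u : V}
    (h : G.IsPath u L u) (n : ℕ) : G.IsPath u (List.replicate n L).flatten u := by
  induction n with
  | zero => rfl
  | succ n ih => rw [List.replicate_succ, List.flatten_cons]; exact h.append ih

/-- The core of the cover corresponding to a finitely generated subgroup has finitely many edges
over every edge. -/
theorem finite_coreEdges (hK : K.FG) (e : E) : {c | (e, c) ∈ G.coreEdges v₀ K}.Finite := by
  refine (finite_cyclic_prefix_cosets hK).subset ?_
  rintro c ⟨he, x, L, hL, hr, s, hs⟩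
  refine ⟨x.1.2, L.map coverProj, ?_, fun n => ?_, ?_, ?_⟩
  · rw [Ne, List.map_eq_nil_iff]
    rintro rfl
    simp at hs
  · have := (hL.flatten_replicate n).isReduced_map_coverProj (hr.flatten_replicate n).isReduced
    simpa [List.map_flatten] using this
  · have := hL.cover_end
    conv_lhs => rw [this]
    exact smul_inv_smul _ _
  · obtain ⟨A, B, rfl⟩ := List.append_of_mem hs
    obtain ⟨y, hA, hB⟩ := hL.split
    have h1 := cover_edge_coset (⟨⟨(e, c), he⟩, s⟩ : G.CoverEdge v₀ K × Bool)
    rw [hB.1] at h1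
    -- An edge is labelled by the coset of its source. Traversed backwards, it reaches that source
    -- only at its end, so the prefix must include the edge itself.
    cases s
    · refine ⟨A.map coverProj ++ [(e, false)], ⟨B.map coverProj, by simp [coverProj]⟩, ?_⟩
      rw [← mul_mk, mul_inv_rev, mul_smul, ← hA.cover_end]
      rw [inv_mk_singleton_false]
      simpa using h1
    · refine ⟨A.map coverProj, ⟨(e, true) :: B.map coverProj, by simp [coverProj]⟩, ?_⟩
      rw [← hA.cover_end]
      simpa using h1

end Cover

/-! ### Segments of bi-infinite lines and their lifts. -/

/-- The segment of length `l` starting at index `i` of a bi-infinite sequence. -/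
def segment {β : Type*} (γ : ℤ → β) : ℤ → ℕ → List β
  | _, 0 => []
  | i, l + 1 => γ i :: segment γ (i + 1) l

theorem segment_add {β : Type*} (γ : ℤ → β) (i : ℤ) (l l' : ℕ) :
    segment γ i (l + l') = segment γ i l ++ segment γ (i + l) l' := by
  induction l generalizing i with
  | zero => simp [segment]
  | succ l ih =>
    have : l + 1 + l' = (l + l') + 1 := by omega
    rw [this]
    have h : i + ((l + 1 : ℕ) : ℤ) = i + 1 + l := by
      push_cast
      ring
    simp only [segment, ih, List.cons_append, h]

theorem eq_segment {β : Type*} (γ : ℤ → β) (i : ℤ) (L : List β)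
    (h : ∀ (j : ℕ) (a : β), L[j]? = some a → γ (i + j) = a) : L = segment γ i L.length := by
  induction L generalizing i with
  | nil => rfl
  | cons b L ih =>
    have h0 := h 0 b rfl
    simp only [List.length_cons, segment]
    rw [← ih (i + 1) fun j a hj => ?_]
    · simpa using h0.symm
    · rw [← h (j + 1) a (by simpa using hj)]
      congr 1
      push_cast
      ring

theorem LiftsTo.exists_reads {F : Type*} [Group F] {G : EdgeGraph V E} {v₀ : V}
    {α : F ≃* G.fundamentalGroup v₀} {H : Subgroup F} {γ : ℤ → E × Bool} (h : LiftsTo α H γ)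
    (i : ℤ) (l : ℕ) : ∃ c, Reads (G.coreEdges v₀ (markedSubgroup α H)) (segment γ i l) c := by
  obtain ⟨γ', hγ', hp⟩ := h
  let δ : ℤ → G.CoverEdge v₀ (markedSubgroup α H) × Bool := fun i => ((γ' i).1.1, (γ' i).2)
  have hδ : ∀ i, (G.cover v₀ (markedSubgroup α H)).terminus (δ i) =
      (G.cover v₀ (markedSubgroup α H)).origin (δ (i + 1)) := by
    intro i
    have h1 := congrArg Subtype.val (hγ' i).1
    have h2 : ∀ a : {e : G.CoverEdge v₀ (markedSubgroup α H) //
        (G.cover v₀ (markedSubgroup α H)).InCore e} × Bool,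
        ((stallingsGraph α H).terminus a).1 =
          (G.cover v₀ (markedSubgroup α H)).terminus (a.1.1, a.2) ∧
        ((stallingsGraph α H).origin a).1 =
          (G.cover v₀ (markedSubgroup α H)).origin (a.1.1, a.2) := by
      rintro ⟨e, s⟩
      cases s <;> exact ⟨rfl, rfl⟩
    rw [(h2 _).1, (h2 _).2] at h1
    exact h1
  refine ⟨((G.cover v₀ (markedSubgroup α H)).origin (δ i)).1.2, ?_⟩
  induction l generalizing i with
  | zero => trivial
  | succ l ih =>
    have hpi : coverProj (δ i) = γ i := hp i
    refine ⟨?_, ?_⟩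
    · have h1 := cover_edge_coset (δ i)
      have h2 : (δ i).1.1 ∈ G.coreEdges v₀ (markedSubgroup α H) := ⟨(δ i).1.2, (γ' i).1.2⟩
      rw [← hpi]
      change ((δ i).1.1.1, if (δ i).2 then _ else _) ∈ _
      change _ = if (δ i).2 then _ else FreeGroup.of (δ i).1.1.1 • _ at h1
      have h3 : ((δ i).1.1.1, (δ i).1.1.2) ∈ G.coreEdges v₀ (markedSubgroup α H) := h2
      rwa [h1] at h3
    · rw [← hpi, ← cover_terminus, hδ]
      exact ih (i + 1)

end EdgeGraph

/-! ### Group actions and iterated endomorphisms. -/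

/-- The preimage of the stabilizer of a point with finite orbit has finite index. -/
theorem MulAction.finiteIndex_comap_stabilizer {F A X : Type*} [Group F] [Group A] [MulAction A X]
    (θ : F →* A) (c : X) (h : (Set.range fun w => θ w • c).Finite) :
    ((MulAction.stabilizer A c).comap θ).FiniteIndex := by
  let _ : MulAction F X := MulAction.compHom X θ
  have h1 : (MulAction.stabilizer A c).comap θ = MulAction.stabilizer F c := by
    ext w
    exact Iff.rfl
  rw [h1, Subgroup.finiteIndex_iff, MulAction.index_stabilizer]
  have h2 : (MulAction.orbit F c).Finite := h
  exact ((Set.ncard_pos h2).2 (MulAction.nonempty_orbit c)).ne'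

theorem MonoidHom.exists_iterate_eq {A : Type*} [Group A] (φ : A →* A) (n : ℕ) :
    ∃ Φ : A →* A, (∀ w, Φ w = φ^[n] w) ∧ Φ.range = (Subgroup.map φ)^[n] ⊤ := by
  induction n with
  | zero =>
    refine ⟨MonoidHom.id A, fun _ => rfl, ?_⟩
    simp [MonoidHom.range_eq_map]
  | succ n ih =>
    obtain ⟨Φ, h1, h2⟩ := ih
    refine ⟨φ.comp Φ, fun w => ?_, ?_⟩
    · simp [Function.iterate_succ_apply', h1]
    · rw [Function.iterate_succ_apply', ← h2, MonoidHom.range_comp]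

/-! ### Iterates of a graph map on paths and on words. -/

namespace EdgeGraph

namespace SelfMap

open FreeGroup

variable {V E : Type*} {G : EdgeGraph V E} (f : G.SelfMap)

/-- The image of an edge path under the `n`-th iterate (no cancellation is performed). -/
def iterPath (n : ℕ) (L : List (E × Bool)) : List (E × Bool) :=
  (fun L => L.flatMap f.onOriented)^[n] L

theorem iterPath_singleton (n : ℕ) (a : E × Bool) : f.iterPath n [a] = f.iter n a := rfl

theorem iterPath_add (m n : ℕ) (L : List (E × Bool)) :
    f.iterPath (m + n) L = f.iterPath m (f.iterPath n L) :=
  Function.iterate_add_apply _ _ _ _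

theorem iterPath_iter (m n : ℕ) (a : E × Bool) :
    f.iterPath m (f.iter n a) = f.iter (m + n) a :=
  (f.iterPath_add m n [a]).symm

theorem iterPath_succ (n : ℕ) (L : List (E × Bool)) :
    f.iterPath (n + 1) L = f.iterPath n (L.flatMap f.onOriented) :=
  Function.iterate_succ_apply _ _ _

theorem iterPath_append (n : ℕ) (L M : List (E × Bool)) :
    f.iterPath n (L ++ M) = f.iterPath n L ++ f.iterPath n M := by
  induction n generalizing L M with
  | zero => rfl
  | succ n ih => rw [iterPath_succ, List.flatMap_append, ih]; rfl

theorem onOriented_opp (a : E × Bool) : f.onOriented (opp a) = invRev (f.onOriented a) := by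
  obtain ⟨e, s⟩ := a
  cases s <;> simp [onOriented, opp, invRev_invRev]

theorem iterPath_invRev (n : ℕ) (L : List (E × Bool)) :
    f.iterPath n (invRev L) = invRev (f.iterPath n L) := by
  induction n generalizing L with
  | zero => rfl
  | succ n ih =>
    rw [iterPath_succ, iterPath_succ, ← ih]
    congr 1
    induction L with
    | nil => rfl
    | cons a L ihL =>
      rw [invRev_cons, List.flatMap_append, ihL, List.flatMap_cons, invRev_append,
        invRev_singleton, List.flatMap_singleton, onOriented_opp]

theorem iter_opp (n : ℕ) (a : E × Bool) : f.iter n (opp a) = invRev (f.iter n a) :=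
  f.iterPath_invRev n [a]

theorem iter_infix_iterPath (n : ℕ) {a : E × Bool} {L : List (E × Bool)} (h : a ∈ L) :
    f.iter n a <:+: f.iterPath n L := by
  obtain ⟨A, B, rfl⟩ := List.append_of_mem h
  refine ⟨f.iterPath n A, f.iterPath n B, ?_⟩
  rw [← iterPath_singleton, ← iterPath_append, ← iterPath_append]
  simp

theorem iterPath_infix (n : ℕ) {L M : List (E × Bool)} (h : L <:+: M) :
    f.iterPath n L <:+: f.iterPath n M := by
  obtain ⟨A, B, rfl⟩ := h
  exact ⟨f.iterPath n A, f.iterPath n B, by simp [iterPath_append]⟩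

theorem isPath_onOriented (a : E × Bool) :
    G.IsPath (f.onV (G.origin a)) (f.onOriented a) (f.onV (G.terminus a)) := by
  obtain ⟨e, s⟩ := a
  cases s
  · simpa [onOriented, origin, terminus] using (f.isPath e).invRev
  · simpa [onOriented, origin, terminus] using f.isPath e

theorem isPath_iterPath (n : ℕ) {L : List (E × Bool)} {u v : V} (h : G.IsPath u L v) :
    G.IsPath (f.onV^[n] u) (f.iterPath n L) (f.onV^[n] v) := by
  induction n generalizing L u v with
  | zero => exact h
  | succ n ih =>
    rw [iterPath_succ, Function.iterate_succ_apply, Function.iterate_succ_apply]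
    refine ih ?_
    induction L generalizing u with
    | nil => cases h; rfl
    | cons a L ihL =>
      rw [List.flatMap_cons, ← h.1]
      exact (f.isPath_onOriented a).append (ihL h.2)

/-- The endomorphism of `FreeGroup E` induced by a graph map. -/
def hom : FreeGroup E →* FreeGroup E := FreeGroup.lift fun e => FreeGroup.mk (f.onE e)

theorem mk_iterPath (n : ℕ) (L : List (E × Bool)) :
    FreeGroup.mk (f.iterPath n L) = f.hom^[n] (FreeGroup.mk L) := by
  induction n generalizing L with
  | zero => rfl
  | succ n ih =>
    rw [iterPath_succ, ih, Function.iterate_succ_apply]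
    congr 1
    induction L with
    | nil => exact (_root_.map_one f.hom).symm
    | cons a L ihL =>
      rw [List.flatMap_cons, ← mul_mk, ihL, ← List.singleton_append (l := L), ← mul_mk, _root_.map_mul]
      congr 1
      obtain ⟨e, s⟩ := a
      cases s <;> simp [hom, onOriented, inv_mk]

/-- The basepoint paths accumulate: each further iteration appends the image `f^n(M)` of the
original path `M`. -/
theorem exists_conj_iterate {F : Type*} [Group F] {v₀ : V} {α : F ≃* G.fundamentalGroup v₀}
    {φ : F →* F} (h : f.Represents α φ) (n : ℕ) :
    ∃ L, G.IsPath v₀ L (f.onV^[n] v₀) ∧ ∀ w : F,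
      ((α (φ^[n] w) : G.fundamentalGroup v₀) : FreeGroup E) =
        FreeGroup.mk L * f.hom^[n] (α w : FreeGroup E) * (FreeGroup.mk L)⁻¹ := by
  obtain ⟨-, -, -, M, hM, hα⟩ := h
  induction n with
  | zero => exact ⟨[], rfl, fun w => by simp [← one_eq_mk]⟩
  | succ n ih =>
    obtain ⟨L, hL, hw⟩ := ih
    refine ⟨L ++ f.iterPath n M, hL.append (f.isPath_iterPath n hM), fun w => ?_⟩
    rw [Function.iterate_succ_apply, hw, hα, ← mul_mk, mk_iterPath,
      iterate_map_mul, iterate_map_mul, iterate_map_inv, Function.iterate_succ_apply]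
    simp only [mul_inv_rev, mul_assoc, hom]

variable {f}

theorem IsTrainTrack.iter_ne_nil (hf : f.IsTrainTrack) (n : ℕ) (a : E × Bool) :
    f.iter n a ≠ [] := by
  rcases Nat.eq_zero_or_pos n with rfl | hn
  · exact List.cons_ne_nil _ _
  · exact ((hf n hn).1 a).1

theorem IsTrainTrack.exists_mem_iter (hf : f.IsTrainTrack) {p : ℕ}
    (hp : ∀ e e' : E, ∃ s, (e, s) ∈ f.iter p (e', true)) {m : ℕ} (hm : p ≤ m) (a : E × Bool)
    (e : E) : ∃ s, (e, s) ∈ f.iter m a := by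
  obtain ⟨k, rfl⟩ := Nat.exists_eq_add_of_le hm
  obtain ⟨b, hb⟩ := List.exists_mem_of_ne_nil _ (hf.iter_ne_nil k a)
  have hinf := f.iter_infix_iterPath p hb
  rw [iterPath_iter] at hinf
  suffices ∃ s, (e, s) ∈ f.iter p b from this.imp fun s hs => hinf.subset hs
  obtain ⟨s, hs⟩ := hp e b.1
  obtain ⟨e', t⟩ := b
  cases t
  · have : f.iter p (e', false) = invRev (f.iter p (e', true)) := f.iter_opp p (e', true)
    rw [this]
    exact ⟨!s, by simpa [invRev] using hs⟩
  · exact ⟨s, hs⟩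

/-- Every iterated image of an edge occurs in every leaf, up to orientation. -/
theorem IsLeaf.exists_infix_segment {γ : ℤ → E × Bool} (hγ : f.IsLeaf γ) (hf : f.IsTrainTrack)
    {p : ℕ} (hp : ∀ e e' : E, ∃ s, (e, s) ∈ f.iter p (e', true)) (n : ℕ) (e : E) :
    ∃ s i l, f.iter n (e, s) <:+: segment γ i l := by
  obtain ⟨-, lam, ℓ, -, -, t, -, -, -, k, hk, m, hm⟩ := hγ
  -- Self-similarity: `f^k` carries segments of the leaf to segments of the leaf, so all `f^(k*j)(γ
  -- 0)` occur in it; the high ones contain `f^n(e)`.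
  have hseg : ∀ (l : ℕ) (i : ℤ), ∃ l' : ℕ, m (i + l) = m i + l' ∧
      f.iterPath k (segment γ i l) = segment γ (m i) l' := by
    intro l
    induction l with
    | zero =>
      refine fun i => ⟨0, by simp, ?_⟩
      have : f.iterPath k [] = [] := by
        have := f.iterPath_append k [] []
        simpa using this
      simpa [segment] using this
    | succ l ih =>
      intro i
      obtain ⟨l', h1, h2⟩ := ih (i + 1)
      refine ⟨(f.iter k (γ i)).length + l', ?_, ?_⟩
      · rw [(by push_cast; ring : i + ((l + 1 : ℕ) : ℤ) = i + 1 + l), h1, (hm i).2.1]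
        push_cast
        ring
      · rw [segment_add γ (m i), ← eq_segment γ (m i) _ (hm i).2.2, ← (hm i).2.1, ← h2]
        simp only [segment]
        rw [← List.singleton_append, iterPath_append]
        rfl
  have hiter : ∀ j : ℕ, ∃ i l, f.iter (k * j) (γ 0) = segment γ i l := by
    intro j
    induction j with
    | zero => exact ⟨0, 1, rfl⟩
    | succ j ih =>
      obtain ⟨i, l, h⟩ := ih
      obtain ⟨l', -, h2⟩ := hseg l i
      refine ⟨m i, l', ?_⟩
      rw [← h2, ← h, iterPath_iter, Nat.mul_succ, Nat.add_comm]
  obtain ⟨i, l, h⟩ := hiter (n + p)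
  have hle : n + p ≤ k * (n + p) := Nat.le_mul_of_pos_left _ hk
  obtain ⟨s, hs⟩ := hf.exists_mem_iter hp (m := k * (n + p) - n) (by omega) (γ 0) e
  refine ⟨s, i, l, ?_⟩
  have hinf := f.iter_infix_iterPath n hs
  rwa [iterPath_iter, show n + (k * (n + p) - n) = k * (n + p) by omega, h] at hinf

/-! ### Stabilization of the number of lifts. -/

section Stabilization

variable {X : Type*} [MulAction (FreeGroup E) X] {C : Set (E × X)}

theorem ncard_reads_iter_orientation (hC : ∀ e, {x | (e, x) ∈ C}.Finite) (n : ℕ) (e : E)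
    (s t : Bool) : {x | Reads C (f.iter n (e, s)) x}.ncard =
      {x | Reads C (f.iter n (e, t)) x}.ncard := by
  have key : {x | Reads C (f.iter n (e, false)) x}.ncard =
      {x | Reads C (f.iter n (e, true)) x}.ncard := by
    rw [← ncard_reads_invRev hC (f.iter n (e, true)), ← iter_opp]
    rfl
  cases s <;> cases t <;> simp [key]

/-- Some iterate has the property that whenever the image of one half-edge at a vertex lifts to `C`
from a given point, so does the image of every half-edge at that vertex. -/
theorem IsClean.exists_iterate_reads [Nonempty E] (hf : f.IsClean)
    (hC : ∀ e, {x | (e, x) ∈ C}.Finite) :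
    ∃ n, ∀ (v : V) (a b : G.HalfEdge v) (x : X),
      Reads C (f.iter n a.1) x → Reads C (f.iter n b.1) x := by
  obtain ⟨⟨⟨hT, -⟩, hW⟩, p, -, hp⟩ := hf
  let N : ℕ × E × Bool → ℕ := fun q => {x | Reads C (f.iter q.1 q.2) x}.ncard
  obtain ⟨⟨n₀, a₀⟩, hmin⟩ : ∃ q, ∀ q', N q ≤ N q' := by
    let q := Function.argmin N
    exact ⟨q, fun q' => Function.argmin_le N q'⟩
  -- From `n₀ + p` on, `f^m(a)` contains the minimizing path `f^n₀(a₀)` or its inverse, so the count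
  -- equals the minimum.
  have hle : ∀ m a, n₀ + p ≤ m → N (m, a) ≤ N (n₀, a₀) := by
    intro m a hm
    obtain ⟨k, rfl⟩ := Nat.exists_eq_add_of_le' (show n₀ ≤ m by omega)
    rw [add_comm] at hm ⊢
    obtain ⟨s, hs⟩ := hT.exists_mem_iter hp (m := k) (by omega) a a₀.1
    have hinf := f.iter_infix_iterPath n₀ hs
    rw [iterPath_iter] at hinf
    refine (ncard_reads_le_of_infix hC (hT.iter_ne_nil _ _) hinf).trans_eq ?_
    exact ncard_reads_iter_orientation hC _ _ _ _
  refine ⟨n₀ + p, ?_⟩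
  set n := n₀ + p with hn
  have hturn : ∀ m d (a b : E × Bool), [opp a, b] <:+: f.iter m d → ∀ x,
      Reads C (f.iter n a) x → Reads C (f.iter n b) x := by
    intro m d a b hab x hx
    have hinf := f.iterPath_infix n hab
    rw [iterPath_iter, ← List.singleton_append, iterPath_append,
      iterPath_singleton, iterPath_singleton] at hinf
    -- The concatenation lies in `f^(n+m)(d)`, which has at least the minimal number of lifts;
    -- `f^n(opp a)` has no more than that.
    have h1 : {x | Reads C (f.iter n (opp a)) x}.ncard ≤
        {x | Reads C (f.iter n (opp a) ++ f.iter n b) x}.ncard :=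
      ((hle n (opp a) le_rfl).trans (hmin (n + m, d))).trans
        (ncard_reads_le_of_infix hC (by simp [hT.iter_ne_nil]) hinf)
    -- The lift of `f^n(a)` from `x`, reversed, ends at `x`; its extension is the lift of `f^n(b)`
    -- from `x`.
    have h2 : Reads C (f.iter n (opp a)) ((FreeGroup.mk (f.iter n a))⁻¹ • x) := by
      rw [iter_opp]
      exact hx.invRev
    have h3 := (reads_append.1 (h2.append_of_ncard_le hC (hT.iter_ne_nil _ _) h1)).2
    rwa [iter_opp, ← inv_mk, inv_inv, smul_inv_smul] at h3
  have hturn' : ∀ m d (a b : E × Bool), [opp a, b] <:+: f.iter m d → ∀ x,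
      Reads C (f.iter n b) x → Reads C (f.iter n a) x := by
    intro m d a b hab
    refine hturn m (opp d) b a ?_
    rw [iter_opp]
    obtain ⟨A, B, h⟩ := hab
    refine ⟨invRev B, invRev A, ?_⟩
    rw [← h]
    simp [invRev, opp]
  intro v a b x
  obtain ⟨w⟩ := (hW v).preconnected a b
  induction w with
  | nil => exact id
  | cons hadj _ ih =>
    intro hx
    refine ih ?_
    obtain ⟨-, m, e, -, h | h⟩ := hadj
    · exact hturn _ _ _ _ h _ hx
    · exact hturn' _ _ _ _ h _ hx

end Stabilization

end SelfMap

end EdgeGraph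

/-! ### Propagation along paths and the main theorem. -/

namespace EdgeGraph

open FreeGroup

variable {V E : Type*}

theorem exists_path_of_mem_coreEdges {G : EdgeGraph V E} {v₀ : V} {K : Subgroup (FreeGroup E)}
    {a : E × Bool} {c : FreeGroup E ⧸ K}
    (h : (a.1, if a.2 then c else FreeGroup.of a.1 • c) ∈ G.coreEdges v₀ K) :
    ∃ M, G.IsPath (G.origin a) M v₀ ∧ c = QuotientGroup.mk (FreeGroup.mk M) := by
  obtain ⟨⟨L, hL, hc⟩, -⟩ := h
  obtain ⟨e, s⟩ := a
  cases s
  · refine ⟨(e, false) :: L, ⟨rfl, by simpa [terminus] using hL⟩, ?_⟩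
    have hc' : FreeGroup.of e • c = QuotientGroup.mk (FreeGroup.mk L) := by simpa using hc
    rw [← List.singleton_append, ← mul_mk, ← inv_inv (FreeGroup.mk [(e, false)]),
      inv_mk_singleton_false, ← inv_smul_smul (FreeGroup.of e) c, hc']
    rfl
  · exact ⟨L, by simpa [origin] using hL, by simpa using hc⟩

/-- After crossing the image of an edge `b`, the reversed lift shows that `f^n(opp b)` lifts from
the new point; `hn` then supplies all other half-edges there. -/
theorem SelfMap.reads_iter_of_isPath {G : EdgeGraph V E} {f : G.SelfMap} {X : Type*}
    [MulAction (FreeGroup E) X] {C : Set (E × X)} {n : ℕ}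
    (hn : ∀ (v : V) (a b : G.HalfEdge v) (x : X),
      Reads C (f.iter n a.1) x → Reads C (f.iter n b.1) x)
    {u v : V} {L : List (E × Bool)} (hL : G.IsPath u L v) {x : X}
    (hx : ∀ a : G.HalfEdge u, Reads C (f.iter n a.1) x) (a : G.HalfEdge v) :
    Reads C (f.iter n a.1) ((FreeGroup.mk (f.iterPath n L))⁻¹ • x) := by
  induction L generalizing u x with
  | nil =>
    cases hL
    simpa [f.mk_iterPath, ← one_eq_mk, iterate_map_one] using hx a
  | cons b L ih =>
    have h1 : f.iterPath n (b :: L) = f.iter n b ++ f.iterPath n L := by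
      rw [← List.singleton_append, f.iterPath_append]
      rfl
    rw [h1, ← mul_mk, mul_inv_rev, mul_smul]
    refine ih hL.2 fun d => ?_
    have ho : G.origin (opp b) = G.terminus b := by
      obtain ⟨e, s⟩ := b
      cases s <;> rfl
    refine hn _ ⟨opp b, ho⟩ d _ ?_
    rw [f.iter_opp]
    exact (hx ⟨b, hL.1⟩).invRev

end EdgeGraph

open EdgeGraph in
theorem mainTheorem5 {F : Type*} [Group F] {n : ℕ} (hn : 2 ≤ n) (basis : FreeGroupBasis (Fin n) F)
    (φ : F →* F) (hφ : Function.Injective φ)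
    {V E : Type*} [Finite V] [Finite E] (Γ : EdgeGraph V E) (f : Γ.SelfMap) (hf : f.IsClean)
    (v₀ : V) (α : F ≃* Γ.fundamentalGroup v₀) (hrep : f.Represents α φ)
    (H : Subgroup F) (hH : H ≠ ⊥) (hfg : H.FG) (hleaf : f.SupportsLeaf α H) :
    ∃ (k : ℕ) (g : F),
      (H.map (MulAut.conj g).toMonoidHom).IsFiniteRelIndex ((Subgroup.map φ)^[k] ⊤) := by
  have hT : f.IsTrainTrack := hf.1.1.1
  obtain ⟨γ, hγ, hlift⟩ := hleaf
  have : Nonempty E := ⟨(γ 0).1⟩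
  have hC : ∀ e, {c | (e, c) ∈ Γ.coreEdges v₀ (markedSubgroup α H)}.Finite :=
    finite_coreEdges (by
      classical
      obtain ⟨S, rfl⟩ := hfg
      exact ⟨S.image ((Γ.fundamentalGroup v₀).subtype.comp α.toMonoidHom), by
        rw [Finset.coe_image, ← MonoidHom.map_closure]
        rfl⟩)
  set C := Γ.coreEdges v₀ (markedSubgroup α H)
  have hne : ∀ k e, ∃ s x, Reads C (f.iter k (e, s)) x := by
    intro k e
    obtain ⟨p, -, hp⟩ := hf.2
    obtain ⟨s, i, l, A, B, h⟩ := hγ.exists_infix_segment hT hp k e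
    obtain ⟨c, hc⟩ := hlift.exists_reads i l
    rw [← h, reads_append, reads_append] at hc
    exact ⟨s, _, hc.1.2⟩
  obtain ⟨k, hk⟩ := hf.exists_iterate_reads hC
  obtain ⟨s, x, hx⟩ := hne k (Classical.arbitrary E)
  obtain ⟨P, hP⟩ := hrep.1.2 (Γ.origin (Classical.arbitrary E, s)) v₀
  have hc := SelfMap.reads_iter_of_isPath hk hP (x := x) fun a => hk _ ⟨_, rfl⟩ a x hx
  set c := (FreeGroup.mk (f.iterPath k P))⁻¹ • x
  obtain ⟨a⟩ := (hf.1.2 v₀).nonempty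
  -- A core edge leaves `c` along the first letter of `f^k(a)`, so `c` is a vertex of the cover over
  -- `f^k(v₀)`; the path `M` enters the conjugator `g`.
  obtain ⟨M, hM, hcM⟩ : ∃ M, Γ.IsPath (f.onV^[k] v₀) M v₀ ∧
      c = QuotientGroup.mk (FreeGroup.mk M) := by
    have h1 := f.isPath_iterPath k (L := [a.1]) (u := v₀) (v := Γ.terminus a.1) ⟨a.2, rfl⟩
    have h2 := hc a
    rw [SelfMap.iterPath_singleton] at h1
    cases h3 : f.iter k a.1 with
    | nil => exact absurd h3 (hT.iter_ne_nil _ _)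
    | cons b L =>
      rw [h3] at h1 h2
      rw [← h1.1]
      exact exists_path_of_mem_coreEdges h2.1
  obtain ⟨Φ, hΦ, hΦr⟩ := φ.exists_iterate_eq k
  obtain ⟨Ψ, hΨ, -⟩ := f.hom.exists_iterate_eq k
  obtain ⟨L, hL, hLα⟩ := f.exists_conj_iterate hrep k
  let θ : F →* FreeGroup E := Ψ.comp ((Γ.fundamentalGroup v₀).subtype.comp α.toMonoidHom)
  have hθ : ∀ w, θ w = f.hom^[k] (α w : FreeGroup E) := fun w => hΨ _
  have hfin : (Set.range fun w => θ w • c).Finite := by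
    refine (finite_reads hC (hT.iter_ne_nil k a.1)).subset ?_
    rintro _ ⟨w, rfl⟩
    -- Words act along paths by their inverses, so `θ w • c` is the endpoint of the lift of the
    -- image of a loop for `w⁻¹`.
    obtain ⟨Q, hQ, hQw⟩ := (α w⁻¹).2
    have h1 : θ w = (FreeGroup.mk (f.iterPath k Q))⁻¹ := by
      rw [SelfMap.mk_iterPath, ← hQw, ← hθ, map_inv, inv_inv]
    change Reads C _ (θ w • c)
    rw [h1]
    exact SelfMap.reads_iter_of_isPath hk hQ hc a
  have hstab := MulAction.finiteIndex_comap_stabilizer θ c hfin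
  -- `L` runs from `v₀` to `f^k(v₀)` and `M` runs back. If `w` fixes `c`, then `M⁻¹ θ(w) M` lies in
  -- `K`, while `φ^k(w)` corresponds to `L θ(w) L⁻¹`; the loop `LM` conjugates one into the other.
  let g : F := α.symm ⟨FreeGroup.mk (L ++ M), L ++ M, hL.append hM, rfl⟩
  have hg : (α g : FreeGroup E) = FreeGroup.mk L * FreeGroup.mk M := by
    simp [g, FreeGroup.mul_mk]
  refine ⟨k, g, ?_⟩
  rw [← hΦr, Subgroup.isFiniteRelIndex_iff_relIndex_ne_zero, ← Subgroup.index_comap,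
    ← Subgroup.finiteIndex_iff]
  refine Subgroup.finiteIndex_of_le (H := (MulAction.stabilizer (FreeGroup E) c).comap θ) ?_
  intro w hw
  have hw' : θ w • c = c := hw
  rw [hcM] at hw'
  obtain ⟨h, hh, hhe⟩ := QuotientGroup.eq.1 hw'.symm
  have hhe' : (α h : FreeGroup E) = (FreeGroup.mk M)⁻¹ * (θ w * FreeGroup.mk M) := hhe
  refine ⟨h, hh, ?_⟩
  change g * h * g⁻¹ = Φ w
  apply α.injective
  apply Subtype.ext
  rw [hΦ, hLα, ← hθ, map_mul, map_mul, map_inv]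
  simp only [Subgroup.coe_mul, Subgroup.coe_inv, hg, hhe']
  group
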